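/- For non-negative integers $n,r,s$ let $a_n(r,s)=\sum_{k=0}^n \binom{n}{k}^r\binom{n+k}{k}^s$ denote the generalised Apéry numbers. Let $r$ and $s$ be positive integers, let $m\ge 0$, and let $n=n_0+3n_1+9n_2+\dots+3^m n_m$ be a non-negative integer, where $0\le n_i\le 2$ for all $i$. Then $$a_n(r,s)\equiv \prod_{i=0}^m a_{n_i}(r,s)+3\sum_{\nu=1}^m\Bigl(\prod_{\substack{0\le i\le m\\ i\ne \nu-1,\nu}} a_{n_i}(r,s)\Bigr) f(n_{\nu-1},n_\nu;r,s)\pmod 9,$$ where, for integers $x,y$, $$f(x,y;r,s)=x(x+1)y\Bigl(s(y+1)+(-1)^s\bigl(s(y-1)+ry\bigr)\Bigr)+\chi(r=1)\,(x+2)(x+1)y+\chi(s=1)\,\bigl((-1)^r-1\bigr)(x-1)x\,y^2,$$ and $\chi(\mathcal S)=1$ if $\mathcal S$ is true and $\chi(\mathcal S)=0$ otherwise. -/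

import Mathlib

/-!
Modulo `p ^ 2`, Lucas' theorem acquires a first-order term: for digits `a, b < p` the quotient of
`(p N + a).choose (p K + b)` by `N.choose K` is an affine function of `N` and `K`, and the same
holds for `(p N + a + p K + b).choose (p K + b)` and `(N + K).choose K`. The slopes are multiples
of `p`, so raising to powers and multiplying is again affine in `(N, K)`, and summing over `b`
splits off the last digit `x` of `n` at the cost of a sum over `K` with a factor `p`. That sum
matters only modulo `p`, where Lucas' theorem splits off the next digit `y`; this gives
`a (p (p M + y) + x) = a x * a (p M + y) + g x y * a M` with `p ∣ g x y`, and induction on the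
number of digits yields the expansion for every prime. For `p = 3` the slopes are evaluated using
`3 * 2 ^ n = 3 * (-1) ^ n` and `3 * 3 ^ n = 3 * 6 ^ n = 0` (`0 < n`) modulo `9`.
-/

/-- The generalised Apéry number `a_n(r,s) = ∑_{k=0}^n (n choose k)^r (n+k choose k)^s`. -/
def aperyNumber (n r s : ℕ) : ℕ :=
  ∑ k ∈ Finset.range (n + 1), n.choose k ^ r * (n + k).choose k ^ s

/-- The correction term `f(x,y;r,s)` attached to a pair of adjacent ternary digits
`x` (the lower one) and `y` (the higher one). -/
def digitCorrection (x y : ℤ) (r s : ℕ) : ℤ :=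
  x * (x + 1) * y * ((s : ℤ) * (y + 1) + (-1) ^ s * ((s : ℤ) * (y - 1) + (r : ℤ) * y))
    + (if r = 1 then 1 else 0) * (x + 2) * (x + 1) * y
    + (if s = 1 then 1 else 0) * ((-1) ^ r - 1) * (x - 1) * x * y ^ 2

theorem cast_succ_mul_choose_succ (R : Type*) [CommRing R] (n k : ℕ) :
    ((k : R) + 1) * n.choose (k + 1) = ((n : R) - k) * n.choose k := by
  rcases le_or_gt k n with h | h
  · have h_nat := congrArg (Nat.cast : ℕ → R) (Nat.choose_succ_right_eq n k)
    push_cast [Nat.cast_sub h] at h_nat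
    linear_combination h_nat
  · simp [Nat.choose_eq_zero_of_lt h, Nat.choose_eq_zero_of_lt (Nat.lt_succ_of_lt h)]

theorem cast_succ_sub_mul_choose_succ (R : Type*) [CommRing R] (n k : ℕ) :
    ((n : R) + 1 - k) * (n + 1).choose k = ((n : R) + 1) * n.choose k := by
  cases k with
  | zero => simp
  | succ k =>
    have h_pascal := congrArg (Nat.cast : ℕ → R) (Nat.choose_succ_succ' n k)
    push_cast at h_pascal ⊢
    linear_combination ((n : R) - k) * h_pascal - cast_succ_mul_choose_succ R n k

theorem natCast_dvd_intCast_of_dvd (R : Type*) [CommRing R] {p : ℕ} {z : ℤ} (h : (p : ℤ) ∣ z) :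
    (p : R) ∣ z := by
  exact_mod_cast Int.cast_dvd_cast (α := R) _ _ h

theorem natCast_dvd_sub_of_modEq (R : Type*) [CommRing R] {p a b : ℕ} (h : a ≡ b [MOD p]) :
    (p : R) ∣ (a : R) - b := by
  exact_mod_cast natCast_dvd_intCast_of_dvd R (Nat.modEq_iff_dvd.1 h.symm)

theorem mul_eq_zero_of_dvd_of_dvd_zmod_sq {p : ℕ} {u v : ZMod (p ^ 2)}
    (hu : (p : ZMod (p ^ 2)) ∣ u) (hv : (p : ZMod (p ^ 2)) ∣ v) : u * v = 0 := by
  have h_sq : (p : ZMod (p ^ 2)) * p = 0 := by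
    rw [← sq, ← Nat.cast_pow, ZMod.natCast_self]
  exact zero_dvd_iff.1 (h_sq ▸ mul_dvd_mul hu hv)

theorem cast_mul_eq_of_modEq_zmod_sq {p : ℕ} {u : ZMod (p ^ 2)} (hu : (p : ZMod (p ^ 2)) ∣ u)
    {a b : ℕ} (h : a ≡ b [MOD p]) : (a : ZMod (p ^ 2)) * u = b * u :=
  sub_eq_zero.1 <| by
    rw [← sub_mul, mul_eq_zero_of_dvd_of_dvd_zmod_sq (natCast_dvd_sub_of_modEq _ h) hu]

section Choose

variable {p : ℕ} [hp : Fact p.Prime]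

theorem choose_mul_add_mul_add_modEq (N K : ℕ) {a b : ℕ} (ha : a < p) (hb : b < p) :
    (p * N + a).choose (p * K + b) ≡ a.choose b * N.choose K [MOD p] := by
  simpa [Nat.mul_add_mod, Nat.mod_eq_of_lt, Nat.mul_add_div hp.out.pos, Nat.div_eq_of_lt, ha, hb]
    using Choose.choose_modEq_choose_mod_mul_choose_div_nat (p := p) (n := p * N + a)
      (k := p * K + b)

theorem choose_add_mul_add_modEq (N K : ℕ) {x b : ℕ} (hx : x < p) (hb : b < p) :
    (p * N + x + (p * K + b)).choose (p * K + b) ≡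
      (x + b).choose b * (N + K).choose K [MOD p] := by
  rcases lt_or_ge (x + b) p with h | h
  · rw [show p * N + x + (p * K + b) = p * (N + K) + (x + b) by ring]
    exact choose_mul_add_mul_add_modEq _ _ h hb
  · obtain ⟨t, ht⟩ := Nat.exists_eq_add_of_le h
    have h_left : (p * N + x + (p * K + b)).choose (p * K + b) ≡ 0 [MOD p] := by
      rw [show p * N + x + (p * K + b) = p * (N + K + 1) + t by linear_combination ht]
      simpa [Nat.choose_eq_zero_of_lt (show t < b by omega)] using
        choose_mul_add_mul_add_modEq (N + K + 1) K (show t < p by omega) hb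
    have h_right : (x + b).choose b ≡ 0 [MOD p] := by
      rw [add_comm] at h ⊢
      exact Nat.modEq_zero_iff_dvd.2 (hp.out.dvd_choose_add hb hx h)
    exact h_left.trans (by simpa using (h_right.mul_right _).symm)

theorem dvd_choose_mul_of_not_dvd (N : ℕ) {j : ℕ} (hj : ¬p ∣ j) : p ∣ (p * N).choose j := by
  have h_lucas := choose_mul_add_mul_add_modEq N (j / p) hp.out.pos (Nat.mod_lt j hp.out.pos)
  have h_mod : 0 < j % p := Nat.pos_of_ne_zero (mt Nat.dvd_of_mod_eq_zero hj)
  rw [add_zero, Nat.div_add_mod, Nat.choose_eq_zero_of_lt h_mod, zero_mul] at h_lucas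
  exact Nat.modEq_zero_iff_dvd.1 h_lucas

theorem choose_mul_choose_mul_eq_zero_zmod_sq (N : ℕ) {i j : ℕ} (hij : p ∣ i + j) (hi0 : i ≠ 0)
    (hip : i ≠ p) : (p.choose i : ZMod (p ^ 2)) * (p * N).choose j = 0 := by
  rcases hip.lt_or_gt with hi | hi
  · have hj : ¬p ∣ j := fun hj =>
      Nat.not_dvd_of_pos_of_lt (Nat.pos_of_ne_zero hi0) hi ((Nat.dvd_add_left hj).1 hij)
    exact mul_eq_zero_of_dvd_of_dvd_zmod_sq (Nat.cast_dvd_cast (hp.out.dvd_choose_self hi0 hi))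
      (Nat.cast_dvd_cast (dvd_choose_mul_of_not_dvd N hj))
  · simp [Nat.choose_eq_zero_of_lt hi]

theorem choose_mul_mul_zmod_sq (N K : ℕ) :
    ((p * N).choose (p * K) : ZMod (p ^ 2)) = N.choose K := by
  induction N generalizing K with
  | zero => rw [mul_zero]; cases K <;> simp [Nat.choose_eq_zero_of_lt, hp.out.pos]
  | succ N ih =>
    cases K with
    | zero => simp
    | succ K =>
      rw [show p * (N + 1) = p + p * N by ring, Nat.add_choose_eq, Nat.cast_sum,
        Finset.sum_eq_add (0, p * (K + 1)) (p, p * K) (by simp [hp.out.ne_zero.symm])]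
      · push_cast
        rw [ih, ih, Nat.choose_succ_succ']
        simp [add_comm]
      -- Every other Vandermonde term is a product of two multiples of `p`.
      · rintro ⟨i, j⟩ hij ⟨h_zero, h_p⟩
        have hij : i + j = p * (K + 1) := Finset.HasAntidiagonal.mem_antidiagonal.1 hij
        rw [Nat.cast_mul]
        refine choose_mul_choose_mul_eq_zero_zmod_sq N (hij ▸ Dvd.intro _ rfl) ?_ ?_
        · rintro rfl
          exact h_zero (by rw [← hij, zero_add])
        · rintro rfl
          exact h_p (Prod.ext rfl (by linarith : j = i * K))
      · simp
      · exact fun h => absurd (Finset.HasAntidiagonal.mem_antidiagonal.2 (by ring)) h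

theorem choose_mul_mul_add_zmod_sq (N K : ℕ) {b : ℕ} (hb0 : b ≠ 0) (hb : b < p) :
    ((p * N).choose (p * K + b) : ZMod (p ^ 2)) =
      ((N : ZMod (p ^ 2)) - K) * N.choose K * p.choose b := by
  obtain ⟨c, rfl⟩ := Nat.exists_eq_add_one_of_ne_zero hb0
  obtain ⟨q, hq⟩ := Nat.exists_eq_add_one_of_ne_zero hp.out.ne_zero
  cases N with
  | zero => rw [mul_zero]; cases K <;> simp [Nat.choose_eq_zero_of_lt, hp.out.pos]
  | succ N =>
    have h_unit : IsUnit ((p * K + (c + 1) : ℕ) : ZMod (p ^ 2)) := by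
      rw [ZMod.isUnit_natCast_iff_not_dvd_pow hp.out two_pos, Nat.dvd_add_right (Dvd.intro _ rfl)]
      exact Nat.not_dvd_of_pos_of_lt c.succ_pos hb
    have h_absorb : p * (N + 1) * (p * N + q).choose (p * K + c) =
        (p * (N + 1)).choose (p * K + (c + 1)) * (p * K + (c + 1)) := by
      rw [show p * (N + 1) = p * N + q + 1 by linear_combination hq]
      exact Nat.add_one_mul_choose_eq (p * N + q) (p * K + c)
    have h_absorb_digit : p * q.choose c = p.choose (c + 1) * (c + 1) := by
      subst hq
      exact Nat.add_one_mul_choose_eq q c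
    have h_lucas := cast_mul_eq_of_modEq_zmod_sq (p := p) dvd_rfl
      (choose_mul_add_mul_add_modEq N K (show q < p by omega) (show c < p by omega))
    have h_p_mul : (p : ZMod (p ^ 2)) * p.choose (c + 1) = 0 :=
      mul_eq_zero_of_dvd_of_dvd_zmod_sq dvd_rfl
        (Nat.cast_dvd_cast (hp.out.dvd_choose_self hb0 hb))
    have h_up := cast_succ_sub_mul_choose_succ (ZMod (p ^ 2)) N K
    replace h_absorb := congrArg (Nat.cast : ℕ → ZMod (p ^ 2)) h_absorb
    replace h_absorb_digit := congrArg (Nat.cast : ℕ → ZMod (p ^ 2)) h_absorb_digit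
    refine h_unit.mul_left_cancel ?_
    push_cast at *
    linear_combination - h_absorb + (N + 1) * h_lucas + (N + 1) * N.choose K * h_absorb_digit
      - (c + 1) * p.choose (c + 1) * h_up
      - K * (N + 1 - K) * (N + 1).choose K * h_p_mul

theorem choose_mul_add_mul_add_zmod_sq (N K : ℕ) {a b : ℕ} (ha : a < p) (hb : b < p) :
    ((p * N + a).choose (p * K + b) : ZMod (p ^ 2)) =
      N.choose K * (a.choose b + (N * ((p + a).choose b - a.choose b)
        + K * ((p + a).choose (p + b) - (p + a).choose b))) := by
  induction a generalizing K b with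
  | zero =>
    rcases Nat.eq_zero_or_pos b with rfl | hb0
    · simp [choose_mul_mul_zmod_sq]
    · rw [add_zero, add_zero, choose_mul_mul_add_zmod_sq N K hb0.ne' hb,
        Nat.choose_eq_zero_of_lt hb0, Nat.choose_eq_zero_of_lt (show p < p + b by omega)]
      push_cast
      ring
  | succ a ih =>
    rcases b with _ | b
    · rcases K with _ | K
      · simp
      · obtain ⟨q, hq⟩ := Nat.exists_eq_add_one_of_ne_zero hp.out.ne_zero
        have h_succ := cast_succ_mul_choose_succ (ZMod (p ^ 2)) N K
        have h_left : (p * N + (a + 1)).choose (p * (K + 1) + 0) =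
            (p * N + a).choose (p * K + q) + (p * N + a).choose (p * (K + 1) + 0) := by
          rw [show p * (K + 1) + 0 = p * K + q + 1 by linear_combination hq]
          exact Nat.choose_succ_succ' _ _
        have h_right : (p + (a + 1)).choose (p + 0) =
            (p + a).choose q + (p + a).choose (p + 0) := by
          conv_lhs => rw [show p + 0 = q + 1 by omega]
          rw [show p + 0 = q + 1 by omega]
          exact Nat.choose_succ_succ' _ _
        rw [h_left, h_right, Nat.cast_add, ih K (by omega) (by omega), ih (K + 1) (by omega) hb,
          Nat.choose_eq_zero_of_lt (show a < q by omega),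
          Nat.choose_eq_zero_of_lt (show p + a < p + q by omega)]
        push_cast [Nat.choose_zero_right]
        linear_combination - (p + a).choose q * h_succ
    · simp only [← add_assoc, Nat.choose_succ_succ', Nat.cast_add]
      rw [ih K (by omega) (by omega), add_assoc (p * K), ih K (by omega) hb, add_assoc p b]
      ring

theorem choose_add_mul_add_zmod_sq_of_le (N K : ℕ) {x b : ℕ} (hx : x < p) (hb : b < p)
    (hxb : p ≤ x + b) :
    ((p * N + x + (p * K + b)).choose (p * K + b) : ZMod (p ^ 2)) =
      (N + K + 1) * (N + K).choose K * (x + b).choose b := by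
  obtain ⟨t, ht⟩ := Nat.exists_eq_add_of_le hxb
  have h_up := cast_succ_sub_mul_choose_succ (ZMod (p ^ 2)) (N + K) K
  rw [show p * N + x + (p * K + b) = p * (N + K + 1) + t by linear_combination ht,
    choose_mul_add_mul_add_zmod_sq _ _ (show t < p by omega) hb, ht,
    Nat.choose_eq_zero_of_lt (show t < b by omega),
    Nat.choose_eq_zero_of_lt (show p + t < p + b by omega)]
  push_cast at h_up ⊢
  linear_combination (p + t).choose b * h_up

theorem choose_add_mul_add_zmod_sq (N K : ℕ) {x b : ℕ} (hx : x < p) (hb : b < p) :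
    ((p * N + x + (p * K + b)).choose (p * K + b) : ZMod (p ^ 2)) =
      (N + K).choose K * ((x + b).choose b + (N * ((p + x + b).choose b - (x + b).choose b)
        + K * ((x + (p + b)).choose (p + b) - (x + b).choose b))) := by
  rcases lt_or_ge (x + b) p with h | h
  · rw [show p * N + x + (p * K + b) = p * (N + K) + (x + b) by ring,
      choose_mul_add_mul_add_zmod_sq _ _ h hb, add_assoc p x b, add_left_comm x p b]
    push_cast
    ring
  · have h_row := choose_add_mul_add_zmod_sq_of_le 1 0 hx hb h
    have h_col := choose_add_mul_add_zmod_sq_of_le 0 1 hx hb h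
    simp only [mul_zero, mul_one, zero_add] at h_row h_col
    rw [choose_add_mul_add_zmod_sq_of_le N K hx hb h, h_row, h_col]
    simp only [Nat.choose_zero_right, Nat.choose_self, add_zero, Nat.cast_one, Nat.cast_zero]
    ring

end Choose

/-- The differential of `u ^ r * v ^ s` at `(u, v)` in the direction `(du, dv)`. -/
def powMulPowDeriv {R : Type*} [CommSemiring R] (r s : ℕ) (u v du dv : R) : R :=
  r * u ^ (r - 1) * v ^ s * du + s * u ^ r * v ^ (s - 1) * dv

theorem add_pow_mul_add_pow_eq_add_powMulPowDeriv {R : Type*} [CommRing R] (r s : ℕ)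
    (u v : R) {du dv : R} (h_uu : du * du = 0) (h_uv : du * dv = 0) (h_vv : dv * dv = 0) :
    (u + du) ^ r * (v + dv) ^ s = u ^ r * v ^ s + powMulPowDeriv r s u v du dv := by
  obtain ⟨k, hk⟩ := Polynomial.powAddExpansion u du r
  obtain ⟨l, hl⟩ := Polynomial.powAddExpansion v dv s
  rw [sq, h_uu, mul_zero, add_zero] at hk
  rw [sq, h_vv, mul_zero, add_zero] at hl
  rw [hk, hl, powMulPowDeriv]
  linear_combination (r * u ^ (r - 1) * s * v ^ (s - 1)) * h_uv

theorem dvd_powMulPowDeriv {R : Type*} [CommSemiring R] (r s : ℕ) (u v : R) {c du dv : R}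
    (hu : c ∣ du) (hv : c ∣ dv) : c ∣ powMulPowDeriv r s u v du dv :=
  dvd_add (hu.mul_left _) (hv.mul_left _)

theorem sum_range_mul {M : Type*} [AddCommMonoid M] (f : ℕ → M) (p n : ℕ) :
    ∑ k ∈ Finset.range (p * n), f k =
      ∑ i ∈ Finset.range n, ∑ j ∈ Finset.range p, f (p * i + j) := by
  induction n with
  | zero => simp
  | succ n ih => rw [mul_add_one, Finset.sum_range_add, ih, Finset.sum_range_succ]

theorem sum_digits_succ (p m : ℕ) (d : ℕ → ℕ) :
    ∑ i ∈ Finset.range (m + 1), d i * p ^ i =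
      p * ∑ i ∈ Finset.range m, d (i + 1) * p ^ i + d 0 := by
  rw [Finset.sum_range_succ', Finset.mul_sum, pow_zero, mul_one]
  exact congrArg (· + d 0) (Finset.sum_congr rfl fun i _ => by ring)

theorem prod_filter_ne_adjacent_succ {R : Type*} [CommMonoid R] (m ν : ℕ) (f : ℕ → R) :
    ∏ i ∈ (Finset.range (m + 1)).filter (fun i => i ≠ ν + 1 ∧ i ≠ ν + 2), f i =
      f 0 * ∏ i ∈ (Finset.range m).filter (fun i => i ≠ ν ∧ i ≠ ν + 1), f (i + 1) := by
  rw [Finset.prod_filter, Finset.prod_filter, Finset.prod_range_succ', mul_comm]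
  simp

theorem sum_Icc_prod_filter_ne_adjacent_succ {R : Type*} [CommSemiring R] (m : ℕ) (f : ℕ → R)
    (g : ℕ → ℕ → R) :
    ∑ ν ∈ Finset.Icc 1 (m + 1),
        (∏ i ∈ (Finset.range (m + 2)).filter (fun i => i ≠ ν - 1 ∧ i ≠ ν), f i) * g (ν - 1) ν =
      g 0 1 * ∏ i ∈ Finset.range m, f (i + 2) +
        f 0 * ∑ ν ∈ Finset.Icc 1 m,
          (∏ i ∈ (Finset.range (m + 1)).filter (fun i => i ≠ ν - 1 ∧ i ≠ ν), f (i + 1)) *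
            g (ν - 1 + 1) (ν + 1) := by
  simp only [← Finset.Ico_add_one_right_eq_Icc, Finset.sum_Ico_eq_sum_range, add_tsub_cancel_right,
    add_comm 1]
  rw [Finset.sum_range_succ', add_comm, Finset.mul_sum]
  congr 1
  · rw [Finset.prod_filter, Finset.prod_range_succ', Finset.prod_range_succ']
    simp [mul_comm]
  · exact Finset.sum_congr rfl fun ν _ => by
      rw [prod_filter_ne_adjacent_succ, mul_assoc]

section Recurrence

variable {R : Type*} [CommSemiring R] {p : ℕ} {a : ℕ → R}

theorem mul_apply_sum_digits_eq_mul_prod {c : R} (h_zero : a 0 = 1)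
    (h_mul : ∀ z < p, ∀ M, c * a (p * M + z) = c * (a z * a M)) (m : ℕ) {d : ℕ → ℕ}
    (hd : ∀ i < m, d i < p) :
    c * a (∑ i ∈ Finset.range m, d i * p ^ i) = c * ∏ i ∈ Finset.range m, a (d i) := by
  induction m generalizing d with
  | zero => simp [h_zero]
  | succ m ih =>
    have h_tail := ih (d := fun i => d (i + 1)) fun i hi => hd _ (by omega)
    rw [sum_digits_succ, h_mul _ (hd 0 (by omega)), Finset.prod_range_succ', mul_left_comm, h_tail]
    ring

theorem apply_sum_digits_eq_prod_add_sum {g : ℕ → ℕ → R} (h_zero : a 0 = 1)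
    (h_rec : ∀ x < p, ∀ y < p, ∀ M,
      a (p * (p * M + y) + x) = a x * a (p * M + y) + g x y * a M)
    (h_mul : ∀ x < p, ∀ y < p, ∀ z < p, ∀ M, g x y * a (p * M + z) = g x y * (a z * a M))
    (m : ℕ) {d : ℕ → ℕ} (hd : ∀ i ≤ m, d i < p) :
    a (∑ i ∈ Finset.range (m + 1), d i * p ^ i) =
      ∏ i ∈ Finset.range (m + 1), a (d i) +
        ∑ ν ∈ Finset.Icc 1 m,
          (∏ i ∈ (Finset.range (m + 1)).filter (fun i => i ≠ ν - 1 ∧ i ≠ ν), a (d i)) *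
            g (d (ν - 1)) (d ν) := by
  induction m generalizing d with
  | zero => simp
  | succ m ih =>
    have h_tail := ih (d := fun i => d (i + 1)) fun i hi => hd _ (by omega)
    have h_correction := mul_apply_sum_digits_eq_mul_prod h_zero
      (h_mul _ (hd 0 (by omega)) _ (hd 1 (by omega))) m (d := fun i => d (i + 2))
      fun i hi => hd _ (by omega)
    have h_second := sum_digits_succ p m fun i => d (i + 1)
    rw [sum_digits_succ, h_second, h_rec _ (hd 0 (by omega)) _ (hd 1 (by omega)), ← h_second,
      h_tail, h_correction, Finset.prod_range_succ' _ (m + 1),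
      sum_Icc_prod_filter_ne_adjacent_succ m (fun i => a (d i)) fun i j => g (d i) (d j)]
    ring

end Recurrence

section Apery

/-- The `k`-th term of the sum defining `aperyNumber n r s`. It makes sense for every `k`, and
vanishes for `n < k` as soon as `r ≠ 0`. -/
def aperySummand (n k r s : ℕ) : ℕ :=
  n.choose k ^ r * (n + k).choose k ^ s

/-- The coefficient of `N` in the first-order expansion of `aperySummand (p * N + x) (p * K + b)`
modulo `p ^ 2`, relative to `aperySummand N K`. -/
def rowSlope (p r s x b : ℕ) : ℤ :=
  powMulPowDeriv r s (x.choose b : ℤ) ((x + b).choose b)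
    ((p + x).choose b - x.choose b) ((p + x + b).choose b - (x + b).choose b)

/-- The coefficient of `K` in the first-order expansion of `aperySummand (p * N + x) (p * K + b)`
modulo `p ^ 2`, relative to `aperySummand N K`. -/
def colSlope (p r s x b : ℕ) : ℤ :=
  powMulPowDeriv r s (x.choose b : ℤ) ((x + b).choose b)
    ((p + x).choose (p + b) - (p + x).choose b)
    ((x + (p + b)).choose (p + b) - (x + b).choose b)

/-- The first-order term at `(N, K)` in the expansion of
`∑ b < p, aperySummand (p * N + x) (p * K + b)` modulo `p ^ 2`, relative to `aperySummand N K`. -/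
def lastDigitCorrection (p r s x N K : ℕ) : ℤ :=
  ∑ b ∈ Finset.range p, (N * rowSlope p r s x b + K * colSlope p r s x b)

/-- The correction attached to adjacent base-`p` digits `x` (the lower one) and `y` (the higher
one) of `n` in the expansion of `aperyNumber n r s` modulo `p ^ 2`. -/
def digitPairCorrection (p r s x y : ℕ) : ℤ :=
  ∑ c ∈ Finset.range p, aperySummand y c r s * lastDigitCorrection p r s x y c

theorem aperyNumber_zero (r s : ℕ) : aperyNumber 0 r s = 1 := by
  simp [aperyNumber]

theorem aperyNumber_eq_sum_aperySummand {r : ℕ} (hr : 1 ≤ r) (s : ℕ) {n L : ℕ} (hn : n < L) :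
    aperyNumber n r s = ∑ k ∈ Finset.range L, aperySummand n k r s := by
  refine Finset.sum_subset (Finset.range_subset_range.2 hn) fun k _ hk => ?_
  have h_le : n + 1 ≤ k := not_lt.1 (mt Finset.mem_range.2 hk)
  rw [Nat.choose_eq_zero_of_lt h_le, zero_pow (by omega), zero_mul]

variable {p : ℕ} [hp : Fact p.Prime]

theorem aperySummand_mul_add_modEq (r s M L : ℕ) {y c : ℕ} (hy : y < p) (hc : c < p) :
    aperySummand (p * M + y) (p * L + c) r s ≡
      aperySummand y c r s * aperySummand M L r s [MOD p] := by
  have h_lucas := ((choose_mul_add_mul_add_modEq M L hy hc).pow r).mul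
    ((choose_add_mul_add_modEq M L hy hc).pow s)
  rwa [mul_pow, mul_pow, mul_mul_mul_comm] at h_lucas

theorem dvd_choose_prime_add_sub_choose {x b : ℕ} (hx : x < p) (hb : b < p) :
    (p : ℤ) ∣ (p + x).choose b - x.choose b :=
  natCast_dvd_sub_of_modEq ℤ (by simpa using choose_mul_add_mul_add_modEq 1 0 hx hb)

theorem dvd_choose_prime_add_add_sub_choose {x b : ℕ} (hx : x < p) (hb : b < p) :
    (p : ℤ) ∣ (p + x + b).choose b - (x + b).choose b :=
  natCast_dvd_sub_of_modEq ℤ (by simpa using choose_add_mul_add_modEq 1 0 hx hb)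

theorem dvd_choose_prime_add_prime_add_sub_choose {x b : ℕ} (hx : x < p) (hb : b < p) :
    (p : ℤ) ∣ (p + x).choose (p + b) - (p + x).choose b := by
  have h_both := choose_mul_add_mul_add_modEq 1 1 hx hb
  have h_upper := choose_mul_add_mul_add_modEq 1 0 hx hb
  simp only [mul_one, mul_zero, zero_add, Nat.choose_self, Nat.choose_zero_right] at h_both h_upper
  exact natCast_dvd_sub_of_modEq ℤ (h_both.trans h_upper.symm)

theorem dvd_choose_add_prime_add_sub_choose {x b : ℕ} (hx : x < p) (hb : b < p) :
    (p : ℤ) ∣ (x + (p + b)).choose (p + b) - (x + b).choose b :=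
  natCast_dvd_sub_of_modEq ℤ (by simpa using choose_add_mul_add_modEq 0 1 hx hb)

theorem dvd_rowSlope (r s : ℕ) {x b : ℕ} (hx : x < p) (hb : b < p) : (p : ℤ) ∣ rowSlope p r s x b :=
  dvd_powMulPowDeriv _ _ _ _ (dvd_choose_prime_add_sub_choose hx hb)
    (dvd_choose_prime_add_add_sub_choose hx hb)

theorem dvd_colSlope (r s : ℕ) {x b : ℕ} (hx : x < p) (hb : b < p) : (p : ℤ) ∣ colSlope p r s x b :=
  dvd_powMulPowDeriv _ _ _ _ (dvd_choose_prime_add_prime_add_sub_choose hx hb)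
    (dvd_choose_add_prime_add_sub_choose hx hb)

theorem dvd_lastDigitCorrection (r s : ℕ) {x : ℕ} (hx : x < p) (N K : ℕ) :
    (p : ℤ) ∣ lastDigitCorrection p r s x N K :=
  Finset.dvd_sum fun _ hb =>
    dvd_add ((dvd_rowSlope r s hx (Finset.mem_range.1 hb)).mul_left _)
      ((dvd_colSlope r s hx (Finset.mem_range.1 hb)).mul_left _)

theorem dvd_digitPairCorrection (r s : ℕ) {x : ℕ} (hx : x < p) (y : ℕ) :
    (p : ℤ) ∣ digitPairCorrection p r s x y :=
  Finset.dvd_sum fun _ _ => (dvd_lastDigitCorrection r s hx _ _).mul_left _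

theorem aperySummand_mul_add_zmod_sq (r s N K : ℕ) {x b : ℕ} (hx : x < p) (hb : b < p) :
    (aperySummand (p * N + x) (p * K + b) r s : ZMod (p ^ 2)) =
      aperySummand N K r s *
        (aperySummand x b r s +
          ((N * rowSlope p r s x b + K * colSlope p r s x b : ℤ) : ZMod (p ^ 2))) := by
  set du : ℤ := N * ((p + x).choose b - x.choose b)
    + K * ((p + x).choose (p + b) - (p + x).choose b) with h_du
  set dv : ℤ := N * ((p + x + b).choose b - (x + b).choose b)
    + K * ((x + (p + b)).choose (p + b) - (x + b).choose b) with h_dv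
  have h_dvd_du : (p : ZMod (p ^ 2)) ∣ du := natCast_dvd_intCast_of_dvd _ <|
    dvd_add ((dvd_choose_prime_add_sub_choose hx hb).mul_left _)
      ((dvd_choose_prime_add_prime_add_sub_choose hx hb).mul_left _)
  have h_dvd_dv : (p : ZMod (p ^ 2)) ∣ dv := natCast_dvd_intCast_of_dvd _ <|
    dvd_add ((dvd_choose_prime_add_add_sub_choose hx hb).mul_left _)
      ((dvd_choose_add_prime_add_sub_choose hx hb).mul_left _)
  have h_expand := add_pow_mul_add_pow_eq_add_powMulPowDeriv r s
    (x.choose b : ZMod (p ^ 2)) ((x + b).choose b)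
    (mul_eq_zero_of_dvd_of_dvd_zmod_sq h_dvd_du h_dvd_du)
    (mul_eq_zero_of_dvd_of_dvd_zmod_sq h_dvd_du h_dvd_dv)
    (mul_eq_zero_of_dvd_of_dvd_zmod_sq h_dvd_dv h_dvd_dv)
  simp only [aperySummand, rowSlope, colSlope, powMulPowDeriv, h_du, h_dv] at h_expand ⊢
  push_cast at h_expand ⊢
  rw [choose_mul_add_mul_add_zmod_sq N K hx hb, choose_add_mul_add_zmod_sq N K hx hb]
  rw [mul_pow, mul_pow, mul_mul_mul_comm, h_expand]
  ring

theorem aperyNumber_mul_add_modEq {r : ℕ} (hr : 1 ≤ r) (s M : ℕ) {y : ℕ} (hy : y < p) :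
    aperyNumber (p * M + y) r s ≡ aperyNumber y r s * aperyNumber M r s [MOD p] := by
  rw [aperyNumber_eq_sum_aperySummand hr s (show p * M + y < p * (M + 1) by linarith),
    aperyNumber_eq_sum_aperySummand hr s hy, aperyNumber_eq_sum_aperySummand hr s M.lt_succ_self,
    sum_range_mul, Finset.sum_mul_sum, Finset.sum_comm]
  exact Nat.ModEq.sum fun c hc => Nat.ModEq.sum fun L _ =>
    aperySummand_mul_add_modEq r s M L hy (Finset.mem_range.1 hc)

theorem aperyNumber_mul_add_zmod_sq {r : ℕ} (hr : 1 ≤ r) (s : ℕ) {N L : ℕ} (hN : N < L) {x : ℕ}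
    (hx : x < p) :
    (aperyNumber (p * N + x) r s : ZMod (p ^ 2)) =
      aperyNumber x r s * aperyNumber N r s +
        ((∑ K ∈ Finset.range L, aperySummand N K r s * lastDigitCorrection p r s x N K : ℤ) :
          ZMod (p ^ 2)) := by
  have h_lt : p * N + x < p * L := by nlinarith
  rw [aperyNumber_eq_sum_aperySummand hr s h_lt, aperyNumber_eq_sum_aperySummand hr s hx,
    aperyNumber_eq_sum_aperySummand hr s hN, sum_range_mul, Int.cast_sum]
  simp only [Nat.cast_sum]
  rw [Finset.mul_sum, ← Finset.sum_add_distrib]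
  refine Finset.sum_congr rfl fun K _ => ?_
  rw [Finset.sum_congr rfl fun b hb =>
    aperySummand_mul_add_zmod_sq r s N K hx (Finset.mem_range.1 hb), ← Finset.mul_sum,
    Finset.sum_add_distrib, lastDigitCorrection, Int.cast_mul, Int.cast_sum, Int.cast_natCast]
  ring

theorem lastDigitCorrection_mul_add_zmod_sq (r s M L : ℕ) {x : ℕ} (hx : x < p) (y c : ℕ) :
    (lastDigitCorrection p r s x (p * M + y) (p * L + c) : ZMod (p ^ 2)) =
      lastDigitCorrection p r s x y c := by
  have h_mod (q z : ℕ) : p * q + z ≡ z [MOD p] := by simp [Nat.ModEq]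
  simp only [lastDigitCorrection, Int.cast_sum, Int.cast_add, Int.cast_mul, Int.cast_natCast]
  refine Finset.sum_congr rfl fun b hb => ?_
  have hb := Finset.mem_range.1 hb
  have h_row := natCast_dvd_intCast_of_dvd (ZMod (p ^ 2)) (dvd_rowSlope r s hx hb)
  have h_col := natCast_dvd_intCast_of_dvd (ZMod (p ^ 2)) (dvd_colSlope r s hx hb)
  rw [cast_mul_eq_of_modEq_zmod_sq h_row (h_mod M y),
    cast_mul_eq_of_modEq_zmod_sq h_col (h_mod L c)]

theorem aperyNumber_mul_mul_add_add_zmod_sq {r : ℕ} (hr : 1 ≤ r) (s M : ℕ) {x y : ℕ} (hx : x < p)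
    (hy : y < p) :
    (aperyNumber (p * (p * M + y) + x) r s : ZMod (p ^ 2)) =
      aperyNumber x r s * aperyNumber (p * M + y) r s +
        digitPairCorrection p r s x y * aperyNumber M r s := by
  rw [aperyNumber_mul_add_zmod_sq hr s (show p * M + y < p * (M + 1) by linarith) hx,
    aperyNumber_eq_sum_aperySummand hr s M.lt_succ_self, sum_range_mul, Finset.sum_comm]
  simp only [digitPairCorrection, Int.cast_sum, Nat.cast_sum, Finset.sum_mul_sum, Int.cast_mul,
    Int.cast_natCast]
  congr 1
  refine Finset.sum_congr rfl fun c hc => Finset.sum_congr rfl fun L _ => ?_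
  have h_lucas := cast_mul_eq_of_modEq_zmod_sq
    (natCast_dvd_intCast_of_dvd _ (dvd_lastDigitCorrection r s hx y c))
    (aperySummand_mul_add_modEq r s M L hy (Finset.mem_range.1 hc))
  rw [lastDigitCorrection_mul_add_zmod_sq r s M L hx, h_lucas, Nat.cast_mul]
  ring

end Apery

theorem theorem1_general {p : ℕ} [Fact p.Prime] (r s : ℕ) (hr : 1 ≤ r) (n m : ℕ) (d : ℕ → ℕ)
    (hd : ∀ i ≤ m, d i < p) (hn : n = ∑ i ∈ Finset.range (m + 1), d i * p ^ i) :
    (aperyNumber n r s : ℤ) ≡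
      (∏ i ∈ Finset.range (m + 1), (aperyNumber (d i) r s : ℤ))
        + ∑ ν ∈ Finset.Icc 1 m,
            (∏ i ∈ (Finset.range (m + 1)).filter (fun i => i ≠ ν - 1 ∧ i ≠ ν),
                (aperyNumber (d i) r s : ℤ))
              * digitPairCorrection p r s (d (ν - 1)) (d ν) [ZMOD (p ^ 2 : ℕ)] := by
  rw [← ZMod.intCast_eq_intCast_iff, hn]
  push_cast
  refine apply_sum_digits_eq_prod_add_sum (a := fun n => (aperyNumber n r s : ZMod (p ^ 2)))
    (g := fun x y => (digitPairCorrection p r s x y : ZMod (p ^ 2)))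
    (by simp [aperyNumber_zero])
    (fun x hx y hy M => aperyNumber_mul_mul_add_add_zmod_sq hr s M hx hy)
    (fun x hx y _ z hz M => ?_) m hd
  have h_lucas := cast_mul_eq_of_modEq_zmod_sq
    (natCast_dvd_intCast_of_dvd _ (dvd_digitPairCorrection r s hx y))
    (aperyNumber_mul_add_modEq hr s M hz)
  rw [mul_comm, h_lucas, Nat.cast_mul, mul_comm]

theorem mul_pow_eq_mul_pow_of_mul_eq_mul {M : Type*} [CommMonoid M] {c a b : M}
    (h : c * a = c * b) (n : ℕ) : c * a ^ n = c * b ^ n := by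
  induction n with
  | zero => rw [pow_zero, pow_zero]
  | succ n ih =>
    rw [pow_succ, ← mul_assoc, ih, mul_right_comm, h, mul_right_comm, pow_succ, mul_assoc]

theorem natCast_mul_zero_pow_sub_one (R : Type*) [CommSemiring R] (n : ℕ) :
    (n : R) * 0 ^ (n - 1) = if n = 1 then 1 else 0 := by
  rcases n with _ | _ | n <;> simp

theorem nine_eq_zero_zmod_nine : (9 : ZMod 9) = 0 := rfl

theorem three_mul_two_pow_zmod_nine (n : ℕ) : (3 : ZMod 9) * 2 ^ n = 3 * (-1) ^ n :=
  mul_pow_eq_mul_pow_of_mul_eq_mul (by decide) n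

theorem three_mul_three_pow_zmod_nine (n : ℕ) : (3 : ZMod 9) * 3 ^ n = 3 * 0 ^ n :=
  mul_pow_eq_mul_pow_of_mul_eq_mul (by decide) n

theorem three_mul_six_pow_zmod_nine (n : ℕ) : (3 : ZMod 9) * 6 ^ n = 3 * 0 ^ n :=
  mul_pow_eq_mul_pow_of_mul_eq_mul (by decide) n

theorem lastDigitCorrection_three_zero {r : ℕ} (hr : 1 ≤ r) (s N K : ℕ) :
    (lastDigitCorrection 3 r s 0 N K : ZMod 9) =
      3 * (N * (2 * if r = 1 then 1 else 0) + K * (-2 * if r = 1 then 1 else 0)) := by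
  have h_r : (0 : ℤ) ^ r = 0 := zero_pow (by omega)
  have h_slope_zero : rowSlope 3 r s 0 0 = 0 ∧ colSlope 3 r s 0 0 = 0 := by
    simp [rowSlope, colSlope, powMulPowDeriv]
  have h_slope_one : rowSlope 3 r s 0 1 = r * 0 ^ (r - 1) * 3 ∧
      colSlope 3 r s 0 1 = r * 0 ^ (r - 1) * -3 := by
    simp [rowSlope, colSlope, powMulPowDeriv, Nat.choose, h_r]
  have h_slope_two : rowSlope 3 r s 0 2 = r * 0 ^ (r - 1) * 3 ∧
      colSlope 3 r s 0 2 = r * 0 ^ (r - 1) * -3 := by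
    simp [rowSlope, colSlope, powMulPowDeriv, Nat.choose, h_r]
  simp only [lastDigitCorrection, Finset.sum_range_succ, Finset.sum_range_zero, h_slope_zero,
    h_slope_one, h_slope_two, natCast_mul_zero_pow_sub_one]
  push_cast
  split_ifs <;> ring

theorem lastDigitCorrection_three_one {r s : ℕ} (hr : 1 ≤ r) (hs : 1 ≤ s) (N K : ℕ) :
    (lastDigitCorrection 3 r s 1 N K : ZMod 9) =
      3 * (N * ((-1) ^ s * (r - s)) + K * ((r + s) - (-1) ^ s * (r + s))) := by
  have h_r : (0 : ℤ) ^ r = 0 := zero_pow (by omega)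
  have h_slope_zero : rowSlope 3 r s 1 0 = 0 ∧ colSlope 3 r s 1 0 = r * 3 + s * 3 := by
    simp [rowSlope, colSlope, powMulPowDeriv, Nat.choose]
  have h_slope_one : rowSlope 3 r s 1 1 = r * 2 ^ s * 3 + s * 2 ^ (s - 1) * 3 ∧
      colSlope 3 r s 1 1 = -(r * 2 ^ s * 3) + s * 2 ^ (s - 1) * 3 := by
    simp [rowSlope, colSlope, powMulPowDeriv, Nat.choose]
  have h_slope_two : rowSlope 3 r s 1 2 = r * 0 ^ (r - 1) * (3 * 3 ^ s) * 2 ∧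
      colSlope 3 r s 1 2 = -(r * 0 ^ (r - 1) * (3 * 3 ^ s) * 2) := by
    simp only [rowSlope, colSlope, powMulPowDeriv, Nat.choose]
    push_cast
    rw [h_r]
    constructor <;> ring
  have h_two := three_mul_two_pow_zmod_nine s
  have h_two_pred : (3 : ZMod 9) * 2 ^ (s - 1) = 3 * -(-1) ^ s := by
    obtain ⟨t, rfl⟩ := Nat.exists_eq_add_of_le' hs
    simpa [pow_succ] using three_mul_two_pow_zmod_nine t
  have h_three : (3 : ZMod 9) * 3 ^ s = 0 := by
    rw [three_mul_three_pow_zmod_nine, zero_pow (by omega), mul_zero]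
  simp only [lastDigitCorrection, Finset.sum_range_succ, Finset.sum_range_zero, h_slope_zero,
    h_slope_one, h_slope_two]
  push_cast
  rw [h_three]
  linear_combination (r * (N - K) : ZMod 9) * h_two + s * (N + K) * h_two_pred

theorem lastDigitCorrection_three_two (r : ℕ) {s : ℕ} (hs : 1 ≤ s) (N K : ℕ) :
    (lastDigitCorrection 3 r s 2 N K : ZMod 9) =
      3 * (N * (((-1) ^ r + 2) * if s = 1 then 1 else 0) +
        K * (((-1) ^ r + 2) * if s = 1 then 1 else 0)) := by
  have h_slope_zero : rowSlope 3 r s 2 0 = 0 ∧ colSlope 3 r s 2 0 = r * 9 + s * 9 := by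
    simp [rowSlope, colSlope, powMulPowDeriv, Nat.choose]
  have h_slope_one :
      rowSlope 3 r s 2 1 = r * 2 ^ (r - 1) * (3 * 3 ^ s) + s * 2 ^ r * (3 * 3 ^ (s - 1)) ∧
      colSlope 3 r s 2 1 = s * 2 ^ r * (3 * 3 ^ (s - 1)) * 4 := by
    simp only [rowSlope, colSlope, powMulPowDeriv, Nat.choose]
    push_cast
    constructor <;> ring
  have h_slope_two : rowSlope 3 r s 2 2 = 9 * (r * 6 ^ s) + s * (3 * 6 ^ (s - 1)) * 5 ∧
      colSlope 3 r s 2 2 = -(9 * (r * 6 ^ s)) + s * (3 * 6 ^ (s - 1)) * 5 := by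
    simp only [rowSlope, colSlope, powMulPowDeriv, Nat.choose]
    push_cast
    constructor <;> ring
  have h_ite := natCast_mul_zero_pow_sub_one (ZMod 9) s
  have h_r := three_mul_two_pow_zmod_nine r
  simp only [lastDigitCorrection, Finset.sum_range_succ, Finset.sum_range_zero, h_slope_zero,
    h_slope_one, h_slope_two]
  push_cast
  rw [three_mul_three_pow_zmod_nine, three_mul_three_pow_zmod_nine, three_mul_six_pow_zmod_nine,
    nine_eq_zero_zmod_nine, zero_pow (by omega : s ≠ 0)]
  rw [← h_ite]
  linear_combination (s * 0 ^ (s - 1) : ZMod 9) *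
    ((N + 4 * K) * h_r + (K * (-1) ^ r + N + K) * nine_eq_zero_zmod_nine)

theorem sum_aperySummand_mul_three_mul {r s : ℕ} (hr : 1 ≤ r) (hs : 1 ≤ s) {y : ℕ} (hy : y ≤ 2)
    (u v : ZMod 9) :
    ∑ c ∈ Finset.range 3, (aperySummand y c r s : ZMod 9) * (3 * (y * u + c * v)) =
      3 * (y * u + if y = 1 then (-1) ^ s * (u + v) else 0) := by
  have h_r : 0 ^ r = 0 := zero_pow (by omega)
  have h_two := three_mul_two_pow_zmod_nine s
  have h_three : (3 : ZMod 9) * 3 ^ s = 0 := by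
    rw [three_mul_three_pow_zmod_nine, zero_pow (by omega), mul_zero]
  have h_six : (3 : ZMod 9) * 6 ^ s = 0 := by
    rw [three_mul_six_pow_zmod_nine, zero_pow (by omega), mul_zero]
  simp only [aperySummand, Finset.sum_range_succ, Finset.sum_range_zero]
  interval_cases y
  · simp [h_r]
  · simp only [Nat.choose, h_r]
    push_cast
    linear_combination (u + v) * h_two
  · simp only [Nat.choose]
    push_cast
    linear_combination (2 ^ r * (2 * u + v)) * h_three + 2 * (u + v) * h_six

theorem digitPairCorrection_three_modEq {r s : ℕ} (hr : 1 ≤ r) (hs : 1 ≤ s) {x y : ℕ}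
    (hx : x ≤ 2) (hy : y ≤ 2) :
    digitPairCorrection 3 r s x y ≡ 3 * digitCorrection x y r s [ZMOD 9] := by
  have h_sq : (-1 : ZMod 9) ^ s * (-1) ^ s = 1 := by rw [← mul_pow, neg_one_mul, neg_neg, one_pow]
  have h_ite : (if s = 1 then 1 else 0) * (-1 : ZMod 9) ^ s = -if s = 1 then 1 else 0 := by
    split_ifs with h <;> simp [h]
  have h_nine := nine_eq_zero_zmod_nine
  refine (ZMod.intCast_eq_intCast_iff _ _ 9).1 ?_
  simp only [digitPairCorrection, digitCorrection, Int.cast_sum, Int.cast_mul, Int.cast_natCast]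
  interval_cases x
  · simp only [lastDigitCorrection_three_zero hr, sum_aperySummand_mul_three_mul hr hs hy]
    split_ifs <;> push_cast <;> ring
  · simp only [lastDigitCorrection_three_one hr hs, sum_aperySummand_mul_three_mul hr hs hy]
    push_cast
    generalize (if r = 1 then 1 else 0 : ZMod 9) = χ
    interval_cases y
    · simp
    · rw [if_pos rfl]
      linear_combination - 6 * s * h_sq - 2 * (s + χ) * h_nine
    · rw [if_neg (by decide)]
      linear_combination - (2 * (-1) ^ s * (s + r) + 4 * (s + χ)) * h_nine
  · simp only [lastDigitCorrection_three_two r hs, sum_aperySummand_mul_three_mul hr hs hy]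
    push_cast
    generalize (if r = 1 then 1 else 0 : ZMod 9) = χ
    generalize (if s = 1 then 1 else 0 : ZMod 9) = ψ at *
    interval_cases y
    · simp
    · rw [if_pos rfl]
      linear_combination 6 * ((-1) ^ r + 2) * h_ite
        - (ψ * (-1) ^ r + 4 * s + 2 * (-1) ^ s * r + 4 * χ) * h_nine
    · rw [if_neg (by decide)]
      linear_combination
        - (ψ * (2 * (-1) ^ r - 4) + 12 * s + (-1) ^ s * (4 * s + 8 * r) + 8 * χ) * h_nine

theorem theorem1 (r s : ℕ) (hr : 1 ≤ r) (hs : 1 ≤ s) (n m : ℕ) (d : ℕ → ℕ)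
    (hd : ∀ i ≤ m, d i ≤ 2) (hn : n = ∑ i ∈ Finset.range (m + 1), d i * 3 ^ i) :
    (aperyNumber n r s : ℤ) ≡
      ((∏ i ∈ Finset.range (m + 1), (aperyNumber (d i) r s : ℤ))
        + 3 * ∑ ν ∈ Finset.Icc 1 m,
            (∏ i ∈ (Finset.range (m + 1)).filter (fun i => i ≠ ν - 1 ∧ i ≠ ν),
                (aperyNumber (d i) r s : ℤ))
              * digitCorrection (d (ν - 1) : ℤ) (d ν : ℤ) r s) [ZMOD 9] := by
  refine (theorem1_general (p := 3) r s hr n m d (fun i hi => Nat.lt_succ_of_le (hd i hi)) hn).trans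
    (Int.ModEq.add_left _ ?_)
  rw [Finset.mul_sum]
  refine Int.ModEq.sum fun ν hν => ?_
  have h_le : ν ≤ m := (Finset.mem_Icc.1 hν).2
  rw [mul_left_comm]
  exact (digitPairCorrection_three_modEq hr hs (hd _ (by omega)) (hd ν h_le)).mul_left _
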